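/- Let $H(\mathbb{C})$ be the space of entire functions with the topology of uniform convergence on compact sets, and let $D:H(\mathbb{C})\to H(\mathbb{C})$, $Df=f'$. Let $(P_n)_{n\ge 1}$ be a sequence of nonconstant complex polynomials, $P_n(z)=\sum_{j=m(n)}^{d(n)}c_{j,n}z^j$ with $c_{m(n),n}\neq 0\neq c_{d(n),n}$ (and $c_{j,n}=0$ for all other $j$); the number $m(n)\ge 0$ is called the valence of $P_n$. Put $P_n(D)f=\sum_{j=m(n)}^{d(n)}c_{j,n}f^{(j)}$ for $f\in H(\mathbb{C})$. Assume that (a) the sequence $(m(n))$ of valences is unbounded, and (b) at least one of the following three properties holds: - (P) there is a set $U\subset\mathbb{C}$ such that $\lim_{n\to\infty}|P_n(z)|=+\infty$ for every $z\in U$, and such that every entire function of exponential type that vanishes on $U$ is identically zero (an entire function $f$ is of exponential type if there are $A,B>0$ with $|f(z)|\le Ae^{B|z|}$ for all $z\in\mathbb{C}$); - (Q) $m(n)\ge 1$ for all large $n$, and for every integer $k\ge 1$ one has $\lim_{n\to\infty}m(n)\,|c_{m(n),n}|^{k/m(n)}=+\infty$ and the sequence $(c_{k+m(n),n})_{n}$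 is bounded; - (R) there is $r>0$ with $\lim_{n\to\infty}\min\{|P_n(z)|:|z|=r\}=+\infty$. Let $HC((P_n(D)))$ be the set of all $f\in H(\mathbb{C})$ whose orbit $\{P_n(D)f:n\ge 1\}$ is dense in $H(\mathbb{C})$. Then $HC((P_n(D)))$ is pointwise $\mathfrak{c}$-spaceable, where $\mathfrak{c}$ is the cardinality of the continuum: for every $f\in HC((P_n(D)))$ there is a closed vector subspace $W$ of $H(\mathbb{C})$ of algebraic dimension $\dim W=\mathfrak{c}$ such that $f\in W\subset HC((P_n(D)))\cup\{0\}$. -/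

import Mathlib

open Filter Topology Polynomial

noncomputable section

namespace EntireHC

/-- The space `H(ℂ)` of entire functions, as a subspace of `C(ℂ, ℂ)`.  Its topology is the one
induced by the compact-open topology of `C(ℂ, ℂ)`, i.e. uniform convergence on compact sets. -/
def entire : Submodule ℂ C(ℂ, ℂ) where
  carrier := {f | Differentiable ℂ f}
  add_mem' hf hg := Differentiable.add hf hg
  zero_mem' := differentiable_const (0 : ℂ)
  smul_mem' c _ hf := Differentiable.const_smul hf c

/-- `H(ℂ)` as a topological vector space. -/
def H : Type := entire

instance : AddCommGroup H := inferInstanceAs (AddCommGroup entire)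
instance : Module ℂ H := inferInstanceAs (Module ℂ entire)
instance : TopologicalSpace H := inferInstanceAs (TopologicalSpace entire)
instance : IsTopologicalAddGroup H := inferInstanceAs (IsTopologicalAddGroup entire)
instance : ContinuousSMul ℂ H := inferInstanceAs (ContinuousSMul ℂ entire)

instance : FunLike H ℂ ℂ where
  coe f := f.1
  coe_injective _ _ h := Subtype.ext (ContinuousMap.ext (congrFun h))

theorem H.differentiable (f : H) : Differentiable ℂ f := f.2

/-- The differentiation operator `f ↦ f'`, as a linear map on `H(ℂ)`. -/
def derivₗ : H →ₗ[ℂ] H where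
  toFun f := ⟨⟨deriv f, (f.differentiable.contDiff (n := 1)).continuous_deriv le_rfl⟩,
    (f.differentiable.contDiff (n := 2)).differentiable_deriv_two⟩
  map_add' f g := DFunLike.ext _ _ fun z => deriv_add (f.differentiable z) (g.differentiable z)
  map_smul' c f := DFunLike.ext _ _ fun z => deriv_const_smul c (f.differentiable z)

theorem continuous_derivₗ : Continuous derivₗ := by
  rw [continuous_iff_continuousAt]
  intro f
  refine tendsto_subtype_rng.mpr ?_
  rw [ContinuousMap.tendsto_iff_tendstoLocallyUniformly, ← tendstoLocallyUniformlyOn_univ]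
  have h : Tendsto (fun g : H => (g.1 : C(ℂ, ℂ))) (𝓝 f) (𝓝 (f.1 : C(ℂ, ℂ))) :=
    continuous_subtype_val.tendsto f
  rw [ContinuousMap.tendsto_iff_tendstoLocallyUniformly, ← tendstoLocallyUniformlyOn_univ] at h
  exact h.deriv (Eventually.of_forall fun g => g.differentiable.differentiableOn) isOpen_univ

/-- The differentiation operator `D` on `H(ℂ)`, as a continuous linear map. -/
def D : H →L[ℂ] H := ⟨derivₗ, continuous_derivₗ⟩

/-- The differential operator `P(D) = ∑ j, c_j D^j` for `P = ∑ j, c_j z^j`. -/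
def diffOp (P : ℂ[X]) : H →L[ℂ] H := aeval D P

/-- The set `HC((T_n))` of hypercyclic vectors: those `x` whose orbit `{T_n x}` is dense. -/
def HC {X Y : Type*} [AddCommGroup X] [Module ℂ X] [TopologicalSpace X]
    [AddCommGroup Y] [Module ℂ Y] [TopologicalSpace Y] (T : ℕ → X →L[ℂ] Y) : Set X :=
  {x | Dense (Set.range fun n => T n x)}

/-- `A` is pointwise `α`-spaceable: each `x ∈ A` lies in a closed vector subspace of (algebraic)
dimension `α` contained in `A ∪ {0}`. -/
def PointwiseSpaceable {X : Type*} [AddCommGroup X] [Module ℂ X] [TopologicalSpace X]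
    (α : Cardinal) (A : Set X) : Prop :=
  ∀ x ∈ A, ∃ W : Submodule ℂ X, IsClosed (W : Set X) ∧ Module.rank ℂ W = α ∧
    x ∈ W ∧ (W : Set X) ⊆ A ∪ {0}

/-- `f` is an entire function of exponential type. -/
def ExponentialType (f : ℂ → ℂ) : Prop :=
  Differentiable ℂ f ∧ ∃ A > (0 : ℝ), ∃ B > (0 : ℝ), ∀ z, ‖f z‖ ≤ A * Real.exp (B * ‖z‖)

/-- `U` is a uniqueness set for the entire functions of exponential type. -/
def UnicitySet (U : Set ℂ) : Prop :=
  ∀ f : ℂ → ℂ, ExponentialType f → (∀ z ∈ U, f z = 0) → ∀ z, f z = 0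

/-- The valence of a (nonzero) polynomial: its order of vanishing at the origin. -/
def valence (P : ℂ[X]) : ℕ := P.natTrailingDegree

/-- Property (P): `|P_n(z)| → ∞` at each point of some uniqueness set. -/
def PropP (P : ℕ → ℂ[X]) : Prop :=
  ∃ U : Set ℂ, UnicitySet U ∧ ∀ z ∈ U, Tendsto (fun n => ‖(P n).eval z‖) atTop atTop

/-- Property (Q): for each `k ≥ 1`, `m(n) |c_{m(n),n}|^{k/m(n)} → ∞` and `(c_{k+m(n),n})_n` is
bounded, where `c_{j,n}` are the coefficients of `P_n` and `m(n)` is its valence. -/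
def PropQ (P : ℕ → ℂ[X]) : Prop :=
  ∀ k : ℕ, 1 ≤ k →
    Tendsto (fun n => (valence (P n) : ℝ) *
      ‖(P n).coeff (valence (P n))‖ ^ ((k : ℝ) / (valence (P n) : ℝ))) atTop atTop ∧
    ∃ C : ℝ, ∀ n, ‖(P n).coeff (k + valence (P n))‖ ≤ C

/-- Property (R): `min {|P_n(z)| : |z| = r} → ∞` for some `r > 0`. -/
def PropR (P : ℕ → ℂ[X]) : Prop :=
  ∃ r > (0 : ℝ),
    Tendsto (fun n => sInf ((fun z => ‖(P n).eval z‖) '' Metric.sphere (0 : ℂ) r)) atTop atTop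

end EntireHC

end

/-! Write `T n` for `P n (D)` and let `f` be hypercyclic. Two facts about `T` drive the proof.
First, the operators commute: if `T n f → 0` along a filter `l` finer than `atTop`, then `T n → 0`
along `l` on the whole orbit of `f`, hence on a dense subspace `X` containing `f`. Second, each of
(P), (Q), (R) makes `liftable T` dense: a dense set of targets `y` is reached as `T n (u n) → y`
with `u n → 0`. Under (P) exponentials are eigenvectors and can be divided by `P n (w)`; (R) reduces
to (P) on a circle; under (Q) a triangular system is solved on monomials.

From this, degrees `N t`, vectors `q t ∈ X` close to `z ^ N t`, indices `n t` and small `v t ∈ X`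
are built inductively, so that `T (n s)` is tiny on all `q t` with `t ≤ s`, sends `v s` close to a
target `Y s`, and hardly sees the other `v t`. For `x = ∑ b t z ^ N t` put `e x = ∑ (b t q t + b (k
t) v t)`; then `T (n s) (e x)` is close to `b (k s) Y s`. If `x ≠ 0`, some `b i ≠ 0`, and the
schedule `(k, Y)` pairs `i` infinitely often with each member of a dense set, so `e x` is
hypercyclic.

The formula for `e` extends to a small perturbation of the identity of `H`, hence to an isomorphism,
so it carries the closed space `lacunary N` to a closed space of dimension `𝔠`. Since also `T (n s)
f → 0`, adding multiples of `f` does no harm, and `W = e (lacunary N) + ℂ f` works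
(`pointwiseSpaceable_HC_of_commute`). -/

noncomputable section

namespace EntireHC

/-! ### Seminorms, convergence and series in the space of entire functions -/

/-- The inclusion of `H(ℂ)` into `C(ℂ, ℂ)`. -/
def toContinuousMapₗ : H →ₗ[ℂ] C(ℂ, ℂ) := entire.subtype

/-- An entire function as an element of `H(ℂ)`. -/
def H.mk (f : ℂ → ℂ) (hf : Differentiable ℂ f) : H := ⟨⟨f, hf.continuous⟩, hf⟩

@[simp] theorem H.mk_apply (f : ℂ → ℂ) (hf : Differentiable ℂ f) (z : ℂ) : H.mk f hf z = f z := rfl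

/-- The restriction of entire functions to the closed disc of radius `R + 1`. -/
def restrictₗ (R : ℕ) : H →ₗ[ℂ] C(Metric.closedBall (0 : ℂ) (R + 1), ℂ) where
  toFun x := (toContinuousMapₗ x).restrict (Metric.closedBall (0 : ℂ) (R + 1))
  map_add' _ _ := rfl
  map_smul' _ _ := rfl

/-- The seminorm `sup_{|z| ≤ R + 1} |x z|` on `H(ℂ)`. -/
def supSeminorm (R : ℕ) : Seminorm ℂ H := (normSeminorm ℂ _).comp (restrictₗ R)

@[simp] theorem H.smul_apply (c : ℂ) (x : H) (z : ℂ) : (c • x) z = c * x z := rfl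
@[simp] theorem H.zero_apply (z : ℂ) : (0 : H) z = 0 := rfl

theorem supSeminorm_le_iff {R : ℕ} {x : H} {C : ℝ} (hC : 0 ≤ C) :
    supSeminorm R x ≤ C ↔ ∀ z : ℂ, ‖z‖ ≤ R + 1 → ‖x z‖ ≤ C := by
  change ‖restrictₗ R x‖ ≤ C ↔ _
  rw [ContinuousMap.norm_le _ hC]
  constructor
  · intro h z hz
    exact h ⟨z, by simpa using hz⟩
  · rintro h ⟨z, hz⟩
    exact h z (by simpa using hz)

theorem norm_apply_le_supSeminorm {R : ℕ} (x : H) {z : ℂ} (hz : ‖z‖ ≤ R + 1) :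
    ‖x z‖ ≤ supSeminorm R x :=
  (supSeminorm_le_iff (apply_nonneg _ _)).1 le_rfl z hz

theorem supSeminorm_mono {R S : ℕ} (h : R ≤ S) (x : H) : supSeminorm R x ≤ supSeminorm S x := by
  refine (supSeminorm_le_iff (apply_nonneg _ _)).2 fun z hz => norm_apply_le_supSeminorm x ?_
  have : (R : ℝ) ≤ S := by exact_mod_cast h
  linarith

theorem continuous_toContinuousMap : Continuous toContinuousMapₗ :=
  continuous_subtype_val

theorem isInducing_toContinuousMap : IsInducing toContinuousMapₗ :=
  IsInducing.subtypeVal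

instance : T2Space H := inferInstanceAs (T2Space entire)

instance : Nontrivial H :=
  ⟨⟨H.mk (fun _ => 1) (differentiable_const _), 0, fun h => by
    simpa using DFunLike.congr_fun h (0 : ℂ)⟩⟩

theorem withSeminorms_supSeminorm : WithSeminorms (supSeminorm : SeminormFamily ℂ H ℕ) := by
  rw [SeminormFamily.withSeminorms_iff_nhds_eq_iInf]
  apply le_antisymm
  · refine le_iInf fun R => ?_
    rw [← tendsto_iff_comap]
    have h0 : Continuous (restrictₗ R) :=
      (ContinuousMap.continuous_restrict _).comp continuous_toContinuousMap
    have h : Continuous (supSeminorm R) := h0.norm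
    simpa using h.tendsto 0
  · rw [isInducing_toContinuousMap.nhds_eq_comap, ← tendsto_iff_comap,
      ContinuousMap.tendsto_iff_forall_isCompact_tendstoUniformlyOn]
    intro K hK
    obtain ⟨r, hr⟩ := hK.isBounded.exists_norm_le
    obtain ⟨R, hR⟩ := exists_nat_ge r
    rw [Metric.tendstoUniformlyOn_iff]
    intro ε hε
    have h1 : Tendsto (supSeminorm R) (⨅ i, comap (supSeminorm i) (𝓝 0)) (𝓝 0) :=
      tendsto_iff_comap.2 (iInf_le _ R)
    filter_upwards [h1.eventually (gt_mem_nhds hε)] with x hx z hz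
    rw [dist_eq_norm]
    change ‖(0 : ℂ) - x z‖ < ε
    rw [zero_sub, norm_neg]
    refine (norm_apply_le_supSeminorm x ?_).trans_lt hx
    have := hr z hz
    linarith

theorem continuous_supSeminorm (R : ℕ) : Continuous (supSeminorm R) :=
  withSeminorms_supSeminorm.continuous_seminorm R

theorem tendsto_nhds_iff_supSeminorm {ι : Type*} {l : Filter ι} {u : ι → H} {x : H} :
    Tendsto u l (𝓝 x) ↔ ∀ R, Tendsto (fun i => supSeminorm R (u i - x)) l (𝓝 0) := by
  constructor
  · intro h R
    have h1 : Tendsto (fun i => u i - x) l (𝓝 0) := by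
      simpa using h.sub (tendsto_const_nhds (x := x))
    have := ((continuous_supSeminorm R).tendsto 0).comp h1
    rwa [map_zero] at this
  · intro h
    rw [withSeminorms_supSeminorm.tendsto_nhds]
    intro R ε hε
    exact (h R).eventually (gt_mem_nhds hε)

theorem tendsto_zero_iff_supSeminorm {ι : Type*} {l : Filter ι} {u : ι → H} :
    Tendsto u l (𝓝 0) ↔ ∀ R, Tendsto (fun i => supSeminorm R (u i)) l (𝓝 0) := by
  simpa using tendsto_nhds_iff_supSeminorm (l := l) (u := u) (x := 0)

theorem exists_supSeminorm_lt_subset {x : H} {U : Set H} (hU : U ∈ 𝓝 x) :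
    ∃ R : ℕ, ∃ ε > 0, ∀ y, supSeminorm R (y - x) < ε → y ∈ U := by
  obtain ⟨s, r, hr, hs⟩ := (withSeminorms_supSeminorm.mem_nhds_iff x U).1 hU
  refine ⟨s.sup id, r, hr, fun y hy => hs ?_⟩
  rw [Seminorm.mem_ball]
  refine Seminorm.finset_sup_apply_lt hr fun i hi => ?_
  exact (supSeminorm_mono (Finset.le_sup (f := id) hi) _).trans_lt hy

theorem exists_supSeminorm_sub_lt {s : Set H} (hs : Dense s) (x : H) (R : ℕ) {ε : ℝ} (hε : 0 < ε) :
    ∃ y ∈ s, supSeminorm R (y - x) < ε := by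
  have hU : {y : H | supSeminorm R (y - x) < ε} ∈ 𝓝 x := by
    refine IsOpen.mem_nhds ?_ (by simpa using hε)
    exact isOpen_lt ((continuous_supSeminorm R).comp (continuous_id.sub continuous_const))
      continuous_const
  obtain ⟨y, h1, h2⟩ := hs.inter_nhds_nonempty hU
  exact ⟨y, h1, h2⟩

/-- Evaluation at a point, as a continuous linear functional. -/
def evalL (z : ℂ) : H →L[ℂ] ℂ where
  toFun x := x z
  map_add' _ _ := rfl
  map_smul' _ _ := rfl
  cont := (continuous_eval_const (F := C(ℂ, ℂ)) z).comp continuous_toContinuousMap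

@[simp] theorem evalL_apply (z : ℂ) (x : H) : evalL z x = x z := rfl

/-- Weierstrass: locally uniform limits of holomorphic functions are holomorphic. This stands in for
completeness when series are summed in `H`. -/
theorem isClosed_range_toContinuousMap : IsClosed (entire : Set C(ℂ, ℂ)) := by
  refine isClosed_of_closure_subset fun f hf => ?_
  have : (𝓝[(entire : Set C(ℂ, ℂ))] f).NeBot := mem_closure_iff_nhdsWithin_neBot.1 hf
  have h : Tendsto id (𝓝[(entire : Set C(ℂ, ℂ))] f) (𝓝 f) := nhdsWithin_le_nhds
  rw [ContinuousMap.tendsto_iff_tendstoLocallyUniformly, ← tendstoLocallyUniformlyOn_univ] at h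
  exact differentiableOn_univ.1 (h.differentiableOn
    (eventually_nhdsWithin_of_forall fun g hg => Differentiable.differentiableOn hg) isOpen_univ)

theorem summable_of_summable_supSeminorm {ι : Type*} {x : ι → H}
    (hx : ∀ R, Summable fun i => supSeminorm R (x i)) : Summable x := by
  have hsum : Summable fun i => toContinuousMapₗ (x i) := by
    refine ContinuousMap.summable_of_locally_summable_norm fun K => ?_
    obtain ⟨r, hr⟩ := K.isCompact.isBounded.exists_norm_le
    obtain ⟨R, hR⟩ := exists_nat_ge r
    refine (hx R).of_nonneg_of_le (fun _ => norm_nonneg _) fun i => ?_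
    refine (ContinuousMap.norm_le _ (apply_nonneg _ _)).2 fun z => ?_
    refine norm_apply_le_supSeminorm (x i) ?_
    have := hr z z.2
    linarith
  obtain ⟨g, hg⟩ := hsum
  have hmem : g ∈ entire :=
    isClosed_range_toContinuousMap.mem_of_tendsto hg
      (Eventually.of_forall fun s => entire.sum_mem fun i _ => (x i).2)
  obtain ⟨y, rfl⟩ : ∃ y : H, toContinuousMapₗ y = g := ⟨⟨g, hmem⟩, rfl⟩
  exact ⟨y, (isInducing_toContinuousMap.hasSum_iff x y).1 hg⟩

theorem supSeminorm_le_of_hasSum {ι : Type*} {x : ι → H} {y : H} (hx : HasSum x y) {R : ℕ}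
    {u : ι → ℝ} {a : ℝ} (hu : HasSum u a) (h : ∀ i, supSeminorm R (x i) ≤ u i) :
    supSeminorm R y ≤ a := by
  have ha : 0 ≤ a := hu.nonneg fun i => (apply_nonneg _ _).trans (h i)
  refine (supSeminorm_le_iff ha).2 fun z hz => ?_
  have h1 : HasSum (fun i => x i z) (y z) := (evalL z).hasSum hx
  rw [← h1.tsum_eq]
  exact tsum_of_norm_bounded hu fun i => (norm_apply_le_supSeminorm _ hz).trans (h i)

/-! ### Cauchy estimates, differential operators and Taylor series -/

theorem D_apply (x : H) (z : ℂ) : D x z = deriv x z := rfl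

theorem D_pow_apply (j : ℕ) (x : H) (z : ℂ) : (D ^ j) x z = iteratedDeriv j x z := by
  induction j generalizing x with
  | zero => simp
  | succ j ih =>
    rw [pow_succ, iteratedDeriv_succ']
    exact ih (D x)

theorem norm_iteratedDeriv_le_supSeminorm (j R : ℕ) (x : H) {z : ℂ} {r : ℝ} (hr : 0 < r)
    (hz : ‖z‖ + r ≤ R + 1) : ‖iteratedDeriv j x z‖ ≤ j.factorial * supSeminorm R x / r ^ j := by
  refine Complex.norm_iteratedDeriv_le_of_forall_mem_sphere_norm_le j hr
    x.differentiable.diffContOnCl fun w hw => norm_apply_le_supSeminorm x ?_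
  rw [mem_sphere_iff_norm] at hw
  calc ‖w‖ = ‖z + (w - z)‖ := by ring_nf
    _ ≤ ‖z‖ + ‖w - z‖ := norm_add_le _ _
    _ ≤ R + 1 := by rw [hw]; exact hz

theorem supSeminorm_D_pow_le (j R : ℕ) (x : H) :
    supSeminorm R ((D ^ j) x) ≤ j.factorial * supSeminorm (R + 1) x := by
  refine (supSeminorm_le_iff (mul_nonneg (by positivity) (apply_nonneg _ _))).2 fun z hz => ?_
  rw [D_pow_apply]
  simpa using norm_iteratedDeriv_le_supSeminorm j (R + 1) x (z := z) one_pos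
    (by push_cast; linarith)

theorem diffOp_apply (P : ℂ[X]) (x : H) :
    diffOp P x = P.sum fun j c => c • (D ^ j) x := by
  rw [diffOp, aeval_def, eval₂_eq_sum, Polynomial.sum, Polynomial.sum]
  simp [Algebra.algebraMap_eq_smul_one]

/-- By Cauchy's estimate on unit circles the loss is one unit of radius, whatever the degree of `P`;
only `C` depends on `P`. The uniform loss is what lets `T n (monom N)` be compared with `(R + 3) ^
N` later. -/
theorem exists_supSeminorm_diffOp_le (P : ℂ[X]) :
    ∃ C, 0 ≤ C ∧ ∀ R x, supSeminorm R (diffOp P x) ≤ C * supSeminorm (R + 1) x := by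
  refine ⟨∑ j ∈ P.support, ‖P.coeff j‖ * j.factorial, by positivity, fun R x => ?_⟩
  rw [diffOp_apply, Polynomial.sum, Finset.sum_mul]
  refine (Finset.le_sum_of_subadditive _ (map_zero _).le (map_add_le_add _) _ _).trans
    (Finset.sum_le_sum fun j _ => ?_)
  rw [map_smul_eq_mul, mul_assoc]
  exact mul_le_mul_of_nonneg_left (supSeminorm_D_pow_le j R x) (norm_nonneg _)

/-- The Taylor coefficient `x ↦ x⁽ʲ⁾(0) / j!`. -/
def taylorCoeff (j : ℕ) : H →L[ℂ] ℂ := ((j.factorial : ℂ)⁻¹) • (evalL 0 ∘L (D ^ j))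

theorem taylorCoeff_apply (j : ℕ) (x : H) :
    taylorCoeff j x = (j.factorial : ℂ)⁻¹ * iteratedDeriv j x 0 := by
  rw [← D_pow_apply]
  rfl

theorem norm_taylorCoeff_mul_le (j R : ℕ) (x : H) :
    ‖taylorCoeff j x‖ * (R + 1 : ℝ) ^ j ≤ supSeminorm R x := by
  have h := norm_iteratedDeriv_le_supSeminorm j R x (z := 0) (r := R + 1) (by positivity) (by simp)
  rw [taylorCoeff_apply, norm_mul, norm_inv, Complex.norm_natCast]
  have h2 : (0 : ℝ) < j.factorial := by positivity
  rw [mul_assoc, inv_mul_le_iff₀ h2]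
  rwa [le_div_iff₀ (by positivity)] at h

theorem norm_taylorCoeff_le (j R : ℕ) (x : H) : ‖taylorCoeff j x‖ ≤ supSeminorm R x := by
  refine le_trans ?_ (norm_taylorCoeff_mul_le j R x)
  refine le_mul_of_one_le_right (norm_nonneg _) (one_le_pow₀ ?_)
  linarith [R.cast_nonneg (α := ℝ)]

/-- The monomial `z ↦ z ^ j` as an entire function. -/
def monom (j : ℕ) : H := H.mk (fun z => z ^ j) (differentiable_id.pow j)

@[simp] theorem monom_apply (j : ℕ) (z : ℂ) : monom j z = z ^ j := rfl

theorem supSeminorm_monom_le (R j : ℕ) : supSeminorm R (monom j) ≤ (R + 1 : ℝ) ^ j := by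
  refine (supSeminorm_le_iff (by positivity)).2 fun z hz => ?_
  rw [monom_apply, norm_pow]
  exact pow_le_pow_left₀ (norm_nonneg _) hz j

theorem taylorCoeff_monom (i j : ℕ) : taylorCoeff i (monom j) = if i = j then 1 else 0 := by
  rw [taylorCoeff_apply]
  change _ * iteratedDeriv i (fun z : ℂ => z ^ j) 0 = _
  rw [iteratedDeriv_fun_pow_zero]
  split_ifs with h
  · subst h
    exact inv_mul_cancel₀ (by exact_mod_cast i.factorial_ne_zero)
  · simp

theorem hasSum_taylorCoeff_smul_monom (x : H) :
    HasSum (fun j => taylorCoeff j x • monom j) x := by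
  have h : Summable fun j => taylorCoeff j x • monom j := by
    refine summable_of_summable_supSeminorm fun R => ?_
    refine (summable_geometric_of_lt_one (r := (R + 1) / (R + 2)) (by positivity)
      ((div_lt_one (by positivity)).2 (by linarith))).mul_left (supSeminorm (R + 1) x)
      |>.of_nonneg_of_le (fun _ => apply_nonneg _ _) fun j => ?_
    rw [map_smul_eq_mul, div_pow, ← mul_div_assoc, le_div_iff₀ (by positivity)]
    have h1 := norm_taylorCoeff_mul_le j (R + 1) x
    push_cast at h1
    rw [add_assoc, one_add_one_eq_two] at h1
    calc _ = ‖taylorCoeff j x‖ * (R + 2 : ℝ) ^ j * supSeminorm R (monom j) := by ring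
      _ ≤ _ := mul_le_mul h1 (supSeminorm_monom_le R j) (apply_nonneg _ _) (apply_nonneg _ _)
  convert h.hasSum
  refine DFunLike.ext _ _ fun z => ?_
  have h1 := (evalL z).hasSum h.hasSum
  have h2 := Complex.hasSum_taylorSeries_of_entire x.differentiable 0 z
  have h3 (j : ℕ) : evalL z (taylorCoeff j x • monom j) =
      (j.factorial : ℂ)⁻¹ • (z - 0) ^ j • iteratedDeriv j x 0 := by
    rw [sub_zero, evalL_apply, H.smul_apply, taylorCoeff_apply, monom_apply, smul_eq_mul,
      smul_eq_mul, mul_assoc, mul_comm (z ^ j)]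
  simp only [h3] at h1
  exact h2.unique h1

theorem taylorCoeff_ext {x y : H} (h : ∀ j, taylorCoeff j x = taylorCoeff j y) : x = y :=
  (hasSum_taylorCoeff_smul_monom x).unique (by
    simpa only [h] using hasSum_taylorCoeff_smul_monom y)

/-! ### Exponentials, the Fourier-Borel transform and dense spans -/

/-- The exponential `z ↦ exp (w z)` as an entire function. -/
def expo (w : ℂ) : H :=
  H.mk (fun z => Complex.exp (w * z)) (by fun_prop)

@[simp] theorem expo_apply (w z : ℂ) : expo w z = Complex.exp (w * z) := rfl

theorem D_expo (w : ℂ) : D (expo w) = w • expo w := by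
  refine DFunLike.ext _ _ fun z => ?_
  rw [D_apply]
  change deriv (fun z => Complex.exp (w * z)) z = w * Complex.exp (w * z)
  have : HasDerivAt (fun z => Complex.exp (w * z)) (Complex.exp (w * z) * (w * 1)) z :=
    ((hasDerivAt_id z).const_mul w).cexp
  rw [this.deriv]; ring

theorem D_pow_expo (j : ℕ) (w : ℂ) : (D ^ j) (expo w) = w ^ j • expo w := by
  induction j with
  | zero => simp
  | succ j ih =>
    rw [pow_succ, mul_apply_eq_comp, D_expo, map_smul, ih, smul_smul, pow_succ']

theorem diffOp_expo (P : ℂ[X]) (w : ℂ) : diffOp P (expo w) = P.eval w • expo w := by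
  rw [diffOp_apply, eval_eq_sum, Polynomial.sum, Polynomial.sum, Finset.sum_smul]
  simp only [D_pow_expo, smul_smul]

theorem D_monom_succ (j : ℕ) : D (monom (j + 1)) = (j + 1 : ℂ) • monom j := by
  refine DFunLike.ext _ _ fun z => ?_
  rw [D_apply]
  change deriv (fun z : ℂ => z ^ (j + 1)) z = (j + 1 : ℂ) * z ^ j
  simp

theorem D_monom_zero : D (monom 0) = 0 := by
  refine DFunLike.ext _ _ fun z => ?_
  rw [D_apply]
  change deriv (fun z : ℂ => z ^ 0) z = 0
  simp

theorem exists_norm_le_supSeminorm (L : H →L[ℂ] ℂ) :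
    ∃ R : ℕ, ∃ C, 0 ≤ C ∧ ∀ x, ‖L x‖ ≤ C * supSeminorm R x := by
  obtain ⟨s, C, -, h⟩ := Seminorm.bound_of_continuous withSeminorms_supSeminorm
    ((normSeminorm ℂ ℂ).comp L.toLinearMap) L.continuous.norm
  refine ⟨s.sup id, C, C.2, fun x => (h x).trans ?_⟩
  refine mul_le_mul_of_nonneg_left ?_ C.2
  exact Seminorm.finset_sup_apply_le (apply_nonneg _ _) fun i hi =>
    supSeminorm_mono (Finset.le_sup (f := id) hi) _

theorem taylorCoeff_eq_of_hasSum {a : ℕ → ℂ} {x : H} (h : HasSum (fun j => a j • monom j) x)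
    (i : ℕ) : taylorCoeff i x = a i := by
  have h1 := (taylorCoeff i).hasSum h
  refine h1.unique ?_
  convert hasSum_ite_eq i (a i) using 2 with j
  rw [map_smul, taylorCoeff_monom, smul_eq_mul]
  by_cases hij : j = i
  · simp [hij]
  · simp [hij, Ne.symm hij]

theorem taylorCoeff_expo (j : ℕ) (w : ℂ) : taylorCoeff j (expo w) = (j.factorial : ℂ)⁻¹ * w ^ j := by
  rw [taylorCoeff_apply, ← D_pow_apply, D_pow_expo]
  simp

theorem supSeminorm_expo_le (R : ℕ) (w : ℂ) :
    supSeminorm R (expo w) ≤ Real.exp ((R + 1) * ‖w‖) := by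
  refine (supSeminorm_le_iff (Real.exp_pos _).le).2 fun z hz => ?_
  rw [expo_apply, Complex.norm_exp]
  refine Real.exp_le_exp.2 ((Complex.re_le_norm _).trans ?_)
  rw [norm_mul, mul_comm]
  exact mul_le_mul_of_nonneg_right hz (norm_nonneg _)

/-- The Fourier-Borel transform `w ↦ L (z ↦ exp (w z))` of a continuous functional on `H(ℂ)` is an
entire function with Taylor coefficients `L (z ^ j) / j!`. -/
theorem exists_fourierBorel (L : H →L[ℂ] ℂ) :
    ∃ F : H, ExponentialType F ∧ (∀ w, F w = L (expo w)) ∧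
      ∀ j, taylorCoeff j F = (j.factorial : ℂ)⁻¹ * L (monom j) := by
  obtain ⟨R, C, hC, hL⟩ := exists_norm_le_supSeminorm L
  have hsum : Summable fun j => ((j.factorial : ℂ)⁻¹ * L (monom j)) • monom j := by
    refine summable_of_summable_supSeminorm fun S => ?_
    refine ((Real.summable_pow_div_factorial ((R + 1) * (S + 1))).mul_left C).of_nonneg_of_le
      (fun _ => apply_nonneg _ _) fun j => ?_
    rw [map_smul_eq_mul, norm_mul, norm_inv, Complex.norm_natCast]
    calc (j.factorial : ℝ)⁻¹ * ‖L (monom j)‖ * supSeminorm S (monom j)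
        ≤ (j.factorial : ℝ)⁻¹ * (C * (R + 1) ^ j) * (S + 1) ^ j := by
          gcongr
          · exact (hL _).trans (mul_le_mul_of_nonneg_left (supSeminorm_monom_le R j) hC)
          · exact supSeminorm_monom_le S j
      _ = _ := by rw [mul_pow]; field_simp
  have hF := hsum.hasSum
  set F : H := ∑' j, ((j.factorial : ℂ)⁻¹ * L (monom j)) • monom j
  have hFw (w : ℂ) : F w = L (expo w) := by
    have h1 := (evalL w).hasSum hF
    have h2 := L.hasSum (hasSum_taylorCoeff_smul_monom (expo w))
    have h3 (j : ℕ) : evalL w (((j.factorial : ℂ)⁻¹ * L (monom j)) • monom j) =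
        L (taylorCoeff j (expo w) • monom j) := by
      rw [map_smul, map_smul, taylorCoeff_expo, evalL_apply, monom_apply, smul_eq_mul, smul_eq_mul]
      ring
    simp only [h3] at h1
    exact h1.unique h2
  refine ⟨F, ⟨F.differentiable, C + 1, by positivity, R + 1, by positivity, fun w => ?_⟩, hFw,
    taylorCoeff_eq_of_hasSum hF⟩
  rw [hFw]
  calc ‖L (expo w)‖ ≤ C * supSeminorm R (expo w) := hL _
    _ ≤ C * Real.exp ((R + 1) * ‖w‖) := mul_le_mul_of_nonneg_left (supSeminorm_expo_le R w) hC
    _ ≤ _ := mul_le_mul_of_nonneg_right (by linarith) (Real.exp_pos _).le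

/-- A continuous functional on `H(ℂ)` is determined by its values on monomials. -/
theorem eq_zero_of_monom {L : H →L[ℂ] ℂ} (h : ∀ j, L (monom j) = 0) : L = 0 := by
  ext x
  have h1 := L.hasSum (hasSum_taylorCoeff_smul_monom x)
  simp only [map_smul, h, smul_zero] at h1
  exact h1.unique hasSum_zero

theorem dense_of_forall_functional (K : Submodule ℂ H)
    (h : ∀ L : H →L[ℂ] ℂ, (∀ x ∈ K, L x = 0) → L = 0) : Dense (K : Set H) := by
  let _ : Module ℝ H := Module.complexToReal H
  have : IsScalarTower ℝ ℂ H := inferInstance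
  have : ContinuousSMul ℝ H := IsScalarTower.continuousSMul ℂ
  have : LocallyConvexSpace ℝ H := withSeminorms_supSeminorm.toLocallyConvexSpace
  by_contra hK
  obtain ⟨v, hv⟩ : ∃ v, v ∉ K.topologicalClosure := by
    by_contra! hall
    exact hK fun v => hall v
  obtain ⟨L, u, hL, hu⟩ := RCLike.geometric_hahn_banach_closed_point (𝕜 := ℂ)
    (s := (K.topologicalClosure : Set H)) (x := v)
    (K.topologicalClosure.restrictScalars ℝ).convex K.isClosed_topologicalClosure hv
  have hLK : ∀ x ∈ K, L x = 0 := by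
    intro x hx
    by_contra hne
    -- A functional bounded above on a subspace vanishes there: this multiple of `x` has value
    -- exactly `u`, against the strict bound.
    have := hL (((u : ℂ) / L x) • x) (K.le_topologicalClosure (K.smul_mem _ hx))
    rw [map_smul, smul_eq_mul, div_mul_cancel₀ _ hne] at this
    simp at this
  have h0 := hL 0 (K.topologicalClosure.zero_mem)
  rw [h L hLK] at hu h0
  simp at hu h0
  linarith

/-- A functional killing `expo w` for `w ∈ U` has a Fourier-Borel transform of exponential type that
vanishes on `U`, hence everywhere; its Taylor coefficients are the values on monomials up to
factorials. -/
theorem dense_span_expo {U : Set ℂ} (hU : UnicitySet U) :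
    Dense (Submodule.span ℂ (expo '' U) : Set H) := by
  refine dense_of_forall_functional _ fun L hL => eq_zero_of_monom fun j => ?_
  obtain ⟨F, hexp, hF, hcoeff⟩ := exists_fourierBorel L
  have hF0 : F = 0 := DFunLike.ext _ _ fun w =>
    hU F hexp (fun z hz => (hF z).trans (hL _ (Submodule.subset_span ⟨z, hz, rfl⟩))) w
  have := hcoeff j
  rw [hF0, map_zero, eq_comm, mul_eq_zero] at this
  exact this.resolve_left (inv_ne_zero (by exact_mod_cast j.factorial_ne_zero))

theorem dense_span_monom : Dense (Submodule.span ℂ (Set.range monom) : Set H) :=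
  dense_of_forall_functional _ fun _ hL => eq_zero_of_monom fun j =>
    hL _ (Submodule.subset_span ⟨j, rfl⟩)

/-! ### Density of the liftable vectors under (P), (R) and (Q) -/

/-- The vectors that are limits of `T n (u n)` for a null sequence `u`. -/
def liftable (T : ℕ → H →L[ℂ] H) : Submodule ℂ H where
  carrier := {y | ∃ u : ℕ → H, Tendsto u atTop (𝓝 0) ∧ Tendsto (fun n => T n (u n)) atTop (𝓝 y)}
  add_mem' := by
    rintro y z ⟨u, hu, hy⟩ ⟨v, hv, hz⟩
    exact ⟨fun n => u n + v n, by simpa using hu.add hv, by simpa using hy.add hz⟩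
  zero_mem' := ⟨0, tendsto_const_nhds, by simp⟩
  smul_mem' := by
    rintro c y ⟨u, hu, hy⟩
    exact ⟨fun n => c • u n, by simpa using hu.const_smul c, by simpa using hy.const_smul c⟩

theorem dense_liftable_of_propP {P : ℕ → ℂ[X]} (h : PropP P) :
    Dense (liftable fun n => diffOp (P n) : Set H) := by
  obtain ⟨U, hU, hlim⟩ := h
  refine (dense_span_expo hU).mono (Submodule.span_le.2 ?_)
  rintro _ ⟨w, hw, rfl⟩
  have hw' := hlim w hw
  refine ⟨fun n => ((P n).eval w)⁻¹ • expo w, ?_, ?_⟩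
  · have : Tendsto (fun n => ((P n).eval w)⁻¹) atTop (𝓝 0) :=
      tendsto_zero_iff_norm_tendsto_zero.2 (by simp only [norm_inv]; exact hw'.inv_tendsto_atTop)
    simpa using this.smul_const (expo w)
  · refine tendsto_const_nhds.congr' ?_
    filter_upwards [hw'.eventually_gt_atTop 0] with n hn
    rw [map_smul, diffOp_expo, inv_smul_smul₀ (norm_pos_iff.1 hn)]

/-- Maximum principle on the disc, then the identity theorem. -/
theorem unicitySet_sphere {r : ℝ} (hr : 0 < r) : UnicitySet (Metric.sphere (0 : ℂ) r) := by
  intro f hf h0 z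
  have h1 : ∀ w ∈ Metric.closedBall (0 : ℂ) r, f w = 0 := by
    have := Complex.eqOn_closure_of_eqOn_frontier (U := Metric.ball (0 : ℂ) r) (f := f) (g := 0)
      Metric.isBounded_ball hf.1.diffContOnCl (differentiable_const _).diffContOnCl
      (by rw [frontier_ball _ hr.ne']; exact fun w hw => h0 w hw)
    rw [closure_ball _ hr.ne'] at this
    exact this
  have h2 : f =ᶠ[𝓝 0] 0 := by
    filter_upwards [Metric.closedBall_mem_nhds (0 : ℂ) hr] with w hw using h1 w hw
  exact congrFun (AnalyticOnNhd.eq_of_eventuallyEq (𝕜 := ℂ)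
    (fun w _ => hf.1.analyticAt w) (fun w _ => analyticAt_const) h2) z

theorem PropR.propP {P : ℕ → ℂ[X]} (h : PropR P) : PropP P := by
  obtain ⟨r, hr, hlim⟩ := h
  refine ⟨Metric.sphere 0 r, unicitySet_sphere hr, fun z hz => ?_⟩
  refine tendsto_atTop_mono (fun n => ?_) hlim
  exact csInf_le ⟨0, by rintro _ ⟨w, -, rfl⟩; exact norm_nonneg _⟩ ⟨z, hz, rfl⟩

/-- The divided monomial `z ↦ z ^ N / N!`. -/
def divMonom (N : ℕ) : H := (N.factorial : ℂ)⁻¹ • monom N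

theorem D_divMonom_succ (N : ℕ) : D (divMonom (N + 1)) = divMonom N := by
  have h1 : (N + 1 : ℂ) ≠ 0 := by exact_mod_cast N.succ_ne_zero
  have h2 : (N.factorial : ℂ) ≠ 0 := by exact_mod_cast N.factorial_ne_zero
  rw [divMonom, divMonom, map_smul, D_monom_succ, smul_smul, Nat.factorial_succ]
  congr 1
  push_cast
  field_simp

theorem D_divMonom_zero : D (divMonom 0) = 0 := by
  rw [divMonom, map_smul, D_monom_zero, smul_zero]

theorem D_pow_divMonom_add (j N : ℕ) : (D ^ j) (divMonom (j + N)) = divMonom N := by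
  induction j with
  | zero => simp
  | succ j ih =>
    rw [pow_succ, mul_apply_eq_comp, show j + 1 + N = j + N + 1 by ring, D_divMonom_succ, ih]

theorem D_pow_divMonom_of_lt {j N : ℕ} (h : N < j) : (D ^ j) (divMonom N) = 0 := by
  obtain ⟨i, rfl⟩ := Nat.exists_eq_add_of_lt h
  have := D_pow_divMonom_add N 0
  rw [add_zero] at this
  rw [show N + i + 1 = i + (1 + N) by ring, pow_add, pow_add, mul_apply_eq_comp, mul_apply_eq_comp,
    this, pow_one, D_divMonom_zero, map_zero]

/-- Orders below the valence have zero coefficient, and orders above `valence P + k` kill the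
monomial. The result is a triangular system with diagonal entry the trailing coefficient. -/
theorem diffOp_divMonom (P : ℂ[X]) (k : ℕ) :
    diffOp P (divMonom (valence P + k)) =
      ∑ i ∈ Finset.range (k + 1), P.coeff (i + valence P) • divMonom (k - i) := by
  rw [diffOp_apply, Polynomial.sum]
  set g : ℕ → H := fun j => P.coeff j • (D ^ j) (divMonom (valence P + k))
  have h1 : ∑ j ∈ P.support, g j =
      ∑ j ∈ P.support ∪ Finset.Ico (valence P) (valence P + (k + 1)), g j := by
    refine Finset.sum_subset Finset.subset_union_left fun j _ hj => ?_
    simp only [g, notMem_support_iff.1 hj, zero_smul]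
  have h2 : ∑ j ∈ Finset.Ico (valence P) (valence P + (k + 1)), g j =
      ∑ j ∈ P.support ∪ Finset.Ico (valence P) (valence P + (k + 1)), g j := by
    refine Finset.sum_subset Finset.subset_union_right fun j _ hj => ?_
    rw [Finset.mem_Ico, not_and_or, not_le, not_lt] at hj
    rcases hj with hj | hj
    · simp only [g, coeff_eq_zero_of_lt_natTrailingDegree hj, zero_smul]
    · simp only [g]
      rw [D_pow_divMonom_of_lt (by omega), smul_zero]
  rw [h1, ← h2, Finset.sum_Ico_eq_sum_range, Nat.add_sub_cancel_left]
  refine Finset.sum_congr rfl fun i hi => ?_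
  have hi' : i ≤ k := Nat.lt_succ_iff.1 (Finset.mem_range.1 hi)
  simp only [g]
  rw [show valence P + k = valence P + i + (k - i) by omega, D_pow_divMonom_add, add_comm i]

theorem supSeminorm_divMonom_le (R N : ℕ) :
    supSeminorm R (divMonom N) ≤ (R + 1 : ℝ) ^ N / N.factorial := by
  rw [divMonom, map_smul_eq_mul, norm_inv, Complex.norm_natCast, div_eq_inv_mul]
  exact mul_le_mul_of_nonneg_left (supSeminorm_monom_le R N) (by positivity)

/-- With `A = m ‖c‖ ^ (s / m)` one has `A ^ m = m ^ m ‖c‖ ^ s`, and `m ^ m ≤ e ^ m m!` bounds the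
left side by `(R + 1) ^ k ((R + 1) e / A) ^ m`. The base is at most `1` by `hA`, so the power `m ≥
1` can be dropped. -/
theorem supSeminorm_inv_pow_smul_divMonom_le {m k s R : ℕ} {c : ℂ} (hm : 1 ≤ m)
    (hA : (R + 1) * Real.exp 1 ≤ m * ‖c‖ ^ ((s : ℝ) / m)) :
    supSeminorm R (c⁻¹ ^ s • divMonom (m + k)) ≤
      (R + 1 : ℝ) ^ k * ((R + 1) * Real.exp 1) * (m * ‖c‖ ^ ((s : ℝ) / m))⁻¹ := by
  set A : ℝ := m * ‖c‖ ^ ((s : ℝ) / m) with hAdef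
  have hm0 : (m : ℝ) ≠ 0 := by positivity
  have hApos : 0 < A := lt_of_lt_of_le (by positivity) hA
  have hApow : A ^ m = (m : ℝ) ^ m * ‖c‖ ^ s := by
    rw [hAdef, mul_pow, ← Real.rpow_natCast (_ ^ _), ← Real.rpow_mul (norm_nonneg _),
      div_mul_cancel₀ _ hm0, Real.rpow_natCast]
  have hcs : 0 < ‖c‖ ^ s := by
    have := pow_pos hApos m
    rw [hApow] at this
    exact pos_of_mul_pos_right this (by positivity)
  have hfac : (m : ℝ) ^ m ≤ Real.exp 1 ^ m * m.factorial := by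
    have := Real.pow_div_factorial_le_exp (m : ℝ) (by positivity) m
    rwa [div_le_iff₀ (by positivity), ← Real.exp_one_pow] at this
  have hfac2 : (m.factorial : ℝ) ≤ (m + k).factorial := by
    exact_mod_cast Nat.factorial_le (Nat.le_add_right m k)
  have h1 : (‖c‖ ^ s)⁻¹ * ((m + k).factorial : ℝ)⁻¹ ≤ (Real.exp 1 / A) ^ m := by
    rw [← mul_inv, div_pow, hApow, inv_le_comm₀ (by positivity) (by positivity), inv_div,
      div_le_iff₀ (by positivity)]
    calc (m : ℝ) ^ m * ‖c‖ ^ s ≤ Real.exp 1 ^ m * (m + k).factorial * ‖c‖ ^ s := by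
          gcongr
          exact hfac.trans (by gcongr)
      _ = _ := by ring
  have h2 : ((R + 1) * Real.exp 1 / A) ^ m ≤ (R + 1) * Real.exp 1 / A :=
    pow_le_of_le_one (by positivity) ((div_le_one hApos).2 hA) (by omega)
  rw [map_smul_eq_mul, norm_pow, norm_inv, inv_pow]
  calc (‖c‖ ^ s)⁻¹ * supSeminorm R (divMonom (m + k))
      ≤ (‖c‖ ^ s)⁻¹ * ((R + 1 : ℝ) ^ (m + k) / (m + k).factorial) := by
        gcongr
        exact supSeminorm_divMonom_le _ _
    _ = (‖c‖ ^ s)⁻¹ * ((m + k).factorial : ℝ)⁻¹ * (R + 1 : ℝ) ^ (m + k) := by ring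
    _ ≤ (Real.exp 1 / A) ^ m * (R + 1 : ℝ) ^ (m + k) := by gcongr
    _ = (R + 1 : ℝ) ^ k * ((R + 1) * Real.exp 1 / A) ^ m := by
        clear_value A
        rw [pow_add, div_pow, div_pow, mul_pow]
        ring
    _ ≤ (R + 1 : ℝ) ^ k * ((R + 1) * Real.exp 1 / A) := by gcongr
    _ = _ := by ring

theorem PropQ.eventually_one_le_valence {P : ℕ → ℂ[X]} (h : PropQ P) :
    ∀ᶠ n in atTop, 1 ≤ valence (P n) := by
  filter_upwards [(h 1 le_rfl).1.eventually_gt_atTop 0] with n hn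
  by_contra h0
  rw [show valence (P n) = 0 by omega] at hn
  simp at hn

theorem PropQ.tendsto_inv_pow_smul_divMonom {P : ℕ → ℂ[X]} (h : PropQ P) (k : ℕ) {s : ℕ}
    (hs : 1 ≤ s) :
    Tendsto (fun n => ((P n).coeff (valence (P n)))⁻¹ ^ s • divMonom (valence (P n) + k))
      atTop (𝓝 0) := by
  rw [tendsto_zero_iff_supSeminorm]
  intro R
  have hlim := (h s hs).1
  have h1 := hlim.inv_tendsto_atTop.const_mul ((R + 1 : ℝ) ^ k * ((R + 1) * Real.exp 1))
  rw [mul_zero] at h1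
  refine tendsto_of_tendsto_of_tendsto_of_le_of_le' tendsto_const_nhds h1
    (Eventually.of_forall fun _ => apply_nonneg _ _) ?_
  filter_upwards [h.eventually_one_le_valence,
    hlim.eventually_ge_atTop ((R + 1) * Real.exp 1)] with n hm hA
  exact supSeminorm_inv_pow_smul_divMonom_le hm hA

/-- Back substitution in the triangular system of `diffOp_divMonom`. Each substitution divides once
more by the trailing coefficient, which may be small, so the induction must carry the decay of `u n`
divided by every power of it. The other coefficients are bounded by (Q). -/
theorem PropQ.exists_preimage_divMonom {P : ℕ → ℂ[X]} (hP : ∀ n, P n ≠ 0) (h : PropQ P) (k : ℕ) :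
    ∃ u : ℕ → H, (∀ s, Tendsto (fun n => ((P n).coeff (valence (P n)))⁻¹ ^ s • u n) atTop (𝓝 0)) ∧
      ∀ n, diffOp (P n) (u n) = divMonom k := by
  induction k using Nat.strong_induction_on with
  | _ k ih =>
  choose! u hu hTu using ih
  refine ⟨fun n => ((P n).coeff (valence (P n)))⁻¹ • (divMonom (valence (P n) + k) -
    ∑ i ∈ Finset.range k, (P n).coeff (i + 1 + valence (P n)) • u (k - (i + 1)) n), fun s => ?_,
    fun n => ?_⟩
  · simp only [smul_smul, ← pow_succ, smul_sub, Finset.smul_sum]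
    rw [← sub_zero (0 : H)]
    refine (h.tendsto_inv_pow_smul_divMonom k s.succ_pos).sub ?_
    rw [← Finset.sum_const_zero (s := Finset.range k)]
    refine tendsto_finsetSum _ fun i hi => ?_
    have hi' := Finset.mem_range.1 hi
    rw [tendsto_zero_iff_supSeminorm]
    intro R
    obtain ⟨C, hC⟩ := (h (i + 1) (by omega)).2
    have h1 := (tendsto_zero_iff_supSeminorm.1 (hu (k - (i + 1)) (by omega) (s + 1)) R).const_mul C
    rw [mul_zero] at h1
    refine squeeze_zero (fun _ => apply_nonneg (supSeminorm R) _) (fun n => ?_) h1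
    rw [show ∀ a b : ℂ, a ^ s * (a * b) = b * a ^ (s + 1) from fun a b => by ring, mul_smul,
      map_smul_eq_mul]
    exact mul_le_mul_of_nonneg_right (hC n) (apply_nonneg (supSeminorm R) _)
  · have hc : (P n).coeff (valence (P n)) ≠ 0 := by
      simpa [valence, trailingCoeff] using (hP n)
    rw [map_smul, map_sub, map_sum, diffOp_divMonom, Finset.sum_range_succ', zero_add, Nat.sub_zero]
    have h1 : ∑ i ∈ Finset.range k, diffOp (P n) ((P n).coeff (i + 1 + valence (P n)) •
        u (k - (i + 1)) n) = ∑ i ∈ Finset.range k, (P n).coeff (i + 1 + valence (P n)) •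
          divMonom (k - (i + 1)) := by
      refine Finset.sum_congr rfl fun i hi => ?_
      have hi' := Finset.mem_range.1 hi
      rw [map_smul, hTu _ (by omega)]
    rw [h1, add_sub_cancel_left, inv_smul_smul₀ hc]

theorem dense_liftable_of_propQ {P : ℕ → ℂ[X]} (hP : ∀ n, P n ≠ 0) (h : PropQ P) :
    Dense (liftable fun n => diffOp (P n) : Set H) := by
  refine dense_span_monom.mono (Submodule.span_le.2 ?_)
  rintro _ ⟨k, rfl⟩
  have hk : (k.factorial : ℂ) ≠ 0 := by exact_mod_cast k.factorial_ne_zero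
  obtain ⟨u, hu, hT⟩ := h.exists_preimage_divMonom hP k
  have h1 : divMonom k ∈ liftable fun n => diffOp (P n) :=
    ⟨u, by simpa using hu 0, by simp [hT]⟩
  rw [show monom k = (k.factorial : ℂ) • divMonom k by rw [divMonom, smul_inv_smul₀ hk]]
  exact Submodule.smul_mem _ _ h1

/-! ### Inductive construction of the stages -/

/-- Course-of-values recursion: `G t` is correct below `t` and has default values from `t` on, which
`hcongr` makes irrelevant; `f` is the diagonal. -/
theorem exists_seq_of_history {α : Type*} [Inhabited α] (r : ℕ → (ℕ → α) → α → Prop)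
    (hcongr : ∀ t g g' a, (∀ i < t, g i = g' i) → r t g a → r t g' a)
    (h : ∀ t g, ∃ a, r t g a) : ∃ f : ℕ → α, ∀ t, r t f (f t) := by
  choose F hF using h
  let G : ℕ → ℕ → α := fun t => Nat.rec (fun _ => default) (fun t g => Function.update g t (F t g)) t
  have hG (t : ℕ) : G (t + 1) = Function.update (G t) t (F t (G t)) := rfl
  have hstable (i k : ℕ) : G (i + 1 + k) i = G (i + 1) i := by
    induction k with
    | zero => rfl
    | succ k ih => rw [← add_assoc, hG, Function.update_of_ne (by omega), ih]
  refine ⟨fun t => G (t + 1) t, fun t => hcongr t (G t) _ _ (fun i hi => ?_) ?_⟩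
  · obtain ⟨k, rfl⟩ := Nat.exists_eq_add_of_lt hi
    rw [show i + k + 1 = i + 1 + k by ring, hstable]
  · change r t (G t) (G (t + 1) t)
    rw [hG, Function.update_self]
    exact hF t (G t)

/-- One step in the construction of a subspace of hypercyclic vectors: a degree `deg`, an
approximation `approx` of the monomial of that degree, an index `idx` and a small vector `corr`
which the operator of index `idx` maps close to a target. -/
structure Stage (X : Submodule ℂ H) where
  deg : ℕ
  approx : X
  idx : ℕ
  corr : X

instance (X : Submodule ℂ H) : Inhabited (Stage X) := ⟨⟨0, 0, 0, 0⟩⟩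

/-- The requirements on the stage `a` number `t`, after the stages `g i`, `i < t`. -/
structure Stage.IsNext {X : Submodule ℂ H} (T : ℕ → H →L[ℂ] H) (Y : ℕ → H) (f : H) (t : ℕ)
    (g : ℕ → Stage X) (a : Stage X) : Prop where
  deg_lt : ∀ i < t, (g i).deg < a.deg
  map_monom : ∀ i < t, ∀ R ≤ i, supSeminorm R (T (g i).idx (monom a.deg)) ≤
    (1 / 2) ^ (i + t) * (R + 3 : ℝ) ^ a.deg
  approx_sub : supSeminorm t (a.approx - monom a.deg) ≤ (1 / 2) ^ t / 8
  map_approx_sub : ∀ i < t, supSeminorm t (T (g i).idx (a.approx - monom a.deg)) ≤ (1 / 2) ^ (i + t)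
  map_approx_self : supSeminorm t (T a.idx a.approx) ≤ (1 / 2) ^ (t + t)
  map_approx : ∀ i < t, supSeminorm t (T a.idx (g i).approx) ≤ (1 / 2) ^ (t + i)
  map_corr_prev : ∀ i < t, supSeminorm t (T a.idx (g i).corr) ≤ (1 / 2) ^ (t + i)
  map_fixed : supSeminorm t (T a.idx f) ≤ (1 / 2) ^ t
  corr_le : supSeminorm t a.corr ≤ (1 / 2) ^ t / 8
  map_corr : ∀ i < t, supSeminorm t (T (g i).idx a.corr) ≤ (1 / 2) ^ (i + t)
  map_corr_self : supSeminorm t (T a.idx a.corr - Y t) ≤ (1 / 2) ^ t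

theorem eventually_nhds_supSeminorm_lt (R : ℕ) (L : H →L[ℂ] H) {x y : H} {ε : ℝ}
    (h : supSeminorm R (L x - y) < ε) : ∀ᶠ x' in 𝓝 x, supSeminorm R (L x' - y) < ε := by
  have h1 : Continuous fun x' => supSeminorm R (L x' - y) :=
    (continuous_supSeminorm R).comp (L.continuous.sub continuous_const)
  exact (h1.tendsto x).eventually_lt_const h

theorem _root_.Filter.Tendsto.eventually_supSeminorm_lt {ι : Type*} {l : Filter ι} {u : ι → H}
    (h : Tendsto u l (𝓝 0)) (R : ℕ) {ε : ℝ} (hε : 0 < ε) : ∀ᶠ i in l, supSeminorm R (u i) < ε :=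
  (tendsto_zero_iff_supSeminorm.1 h R).eventually_lt_const hε

/-- `L` costs one unit of radius, so the left side is at most `C (R + 2) ^ N`, which is negligible
against `(R + 3) ^ N`. -/
theorem eventually_supSeminorm_map_monom_le {L : H →L[ℂ] H} {C : ℝ} (hC : 0 ≤ C)
    (hL : ∀ R x, supSeminorm R (L x) ≤ C * supSeminorm (R + 1) x) (R : ℕ) {ε : ℝ} (hε : 0 < ε) :
    ∀ᶠ N in atTop, supSeminorm R (L (monom N)) ≤ ε * (R + 3 : ℝ) ^ N := by
  have h1 : Tendsto (fun N : ℕ => C * ((R + 2 : ℝ) / (R + 3)) ^ N) atTop (𝓝 (C * 0)) :=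
    (tendsto_pow_atTop_nhds_zero_of_lt_one (by positivity)
      ((div_lt_one (by positivity)).2 (by linarith))).const_mul C
  rw [mul_zero] at h1
  filter_upwards [h1.eventually_lt_const hε] with N hN
  refine (hL R _).trans ?_
  rw [div_pow, ← mul_div_assoc, div_lt_iff₀ (by positivity)] at hN
  refine le_trans (mul_le_mul_of_nonneg_left (supSeminorm_monom_le _ _) hC) ?_
  push_cast
  rw [add_assoc, one_add_one_eq_two]
  exact hN.le

/-- The order of choice matters. The degree `N` is taken large for the earlier operators, then `q ∈
X` close to `monom N`. A liftable `y` near `Y t` supplies `u`. Next `n` is taken along `l`, where `T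
n` is small on the finitely many vectors of `X` chosen so far and `u n` is small. Only then, with
`n` fixed, is `u n` replaced by a nearby `v ∈ X`. -/
theorem exists_stage {X : Submodule ℂ H} (hX : Dense (X : Set H)) {T : ℕ → H →L[ℂ] H}
    (hT : ∀ n, ∃ C, 0 ≤ C ∧ ∀ R x, supSeminorm R (T n x) ≤ C * supSeminorm (R + 1) x)
    {l : Filter ℕ} [l.NeBot] (hl : l ≤ atTop) (hX0 : ∀ x ∈ X, Tendsto (fun n => T n x) l (𝓝 0))
    (hlift : Dense (liftable T : Set H)) (Y : ℕ → H) {f : H} (hf : f ∈ X) (t : ℕ)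
    (g : ℕ → Stage X) : ∃ a, Stage.IsNext T Y f t g a := by
  have hfin : {i | i < t}.Finite := Set.finite_lt_nat t
  obtain ⟨N, hN1, hN2⟩ : ∃ N, (∀ i < t, (g i).deg < N) ∧ ∀ i < t, ∀ R ≤ i,
      supSeminorm R (T (g i).idx (monom N)) ≤ (1 / 2) ^ (i + t) * (R + 3 : ℝ) ^ N := by
    refine (((eventually_all_finite hfin).2 fun i _ => eventually_gt_atTop _).and
      ((eventually_all_finite hfin).2 fun i _ =>
        (eventually_all_finite (Set.finite_le_nat i)).2 fun R _ => ?_)).exists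
    obtain ⟨C, hC, hL⟩ := hT (g i).idx
    exact eventually_supSeminorm_map_monom_le hC hL R (by positivity)
  obtain ⟨q, ⟨hq1, hq2⟩, hqX⟩ : ∃ q, (supSeminorm t (q - monom N) < (1 / 2) ^ t / 8 ∧
      ∀ i < t, supSeminorm t (T (g i).idx (q - monom N)) < (1 / 2) ^ (i + t)) ∧ q ∈ X := by
    refine ((mem_closure_iff_frequently.1 (hX (monom N))).and_eventually ?_).exists.imp
      fun _ h => h.symm
    refine (eventually_nhds_supSeminorm_lt t (ContinuousLinearMap.id ℂ H) (by simp)).and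
      ((eventually_all_finite hfin).2 fun i _ => ?_)
    simp only [map_sub]
    exact eventually_nhds_supSeminorm_lt t _ (by simp)
  obtain ⟨y, hy, hyY⟩ := exists_supSeminorm_sub_lt hlift (Y t) t (ε := (1 / 2) ^ t) (by positivity)
  obtain ⟨u, hu, hTu⟩ := hy
  obtain ⟨n, ⟨hn1, hn2, hn3, hn4⟩, hn5, hn6, hn7⟩ : ∃ n,
      (supSeminorm t (T n q) < (1 / 2) ^ (t + t) ∧
      (∀ i < t, supSeminorm t (T n (g i).approx) < (1 / 2) ^ (t + i)) ∧
      (∀ i < t, supSeminorm t (T n (g i).corr) < (1 / 2) ^ (t + i)) ∧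
      supSeminorm t (T n f) < (1 / 2) ^ t) ∧
      supSeminorm t (u n) < (1 / 2) ^ t / 8 ∧
      (∀ i < t, supSeminorm t (T (g i).idx (u n)) < (1 / 2) ^ (i + t)) ∧
      supSeminorm t (T n (u n) - Y t) < (1 / 2) ^ t := by
    refine Eventually.exists (f := l) (Eventually.and ?_ (Eventually.filter_mono hl ?_))
    · exact ((hX0 q hqX).eventually_supSeminorm_lt t (by positivity)).and
        (((eventually_all_finite hfin).2 fun i _ =>
          (hX0 _ (g i).approx.2).eventually_supSeminorm_lt t (by positivity)).and
        (((eventually_all_finite hfin).2 fun i _ =>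
          (hX0 _ (g i).corr.2).eventually_supSeminorm_lt t (by positivity)).and
        ((hX0 f hf).eventually_supSeminorm_lt t (by positivity))))
    · refine (hu.eventually_supSeminorm_lt t (by positivity)).and
        (((eventually_all_finite hfin).2 fun i _ => ?_).and ?_)
      · have h1 := ((T (g i).idx).continuous.tendsto 0).comp hu
        rw [map_zero] at h1
        exact h1.eventually_supSeminorm_lt t (by positivity)
      · exact hTu.eventually (eventually_nhds_supSeminorm_lt t (ContinuousLinearMap.id ℂ H) hyY)
  obtain ⟨v, ⟨hv1, hv2, hv3⟩, hvX⟩ : ∃ v, (supSeminorm t v < (1 / 2) ^ t / 8 ∧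
      (∀ i < t, supSeminorm t (T (g i).idx v) < (1 / 2) ^ (i + t)) ∧
      supSeminorm t (T n v - Y t) < (1 / 2) ^ t) ∧ v ∈ X := by
    refine ((mem_closure_iff_frequently.1 (hX (u n))).and_eventually ?_).exists.imp
      fun _ h => h.symm
    refine Eventually.and ?_ (((eventually_all_finite hfin).2 fun i hi => ?_).and
      (eventually_nhds_supSeminorm_lt t _ hn7))
    · simpa using eventually_nhds_supSeminorm_lt t (ContinuousLinearMap.id ℂ H) (y := 0)
        (by simpa using hn5)
    · simpa using eventually_nhds_supSeminorm_lt t (T (g i).idx) (y := 0)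
        (by simpa using hn6 i hi)
  exact ⟨⟨N, ⟨q, hqX⟩, n, ⟨v, hvX⟩⟩, hN1, hN2, hq1.le, fun i hi => (hq2 i hi).le, hn1.le,
    fun i hi => (hn2 i hi).le, fun i hi => (hn3 i hi).le, hn4.le, hv1.le,
    fun i hi => (hv2 i hi).le, hv3.le⟩

theorem exists_stages {X : Submodule ℂ H} (hX : Dense (X : Set H)) {T : ℕ → H →L[ℂ] H}
    (hT : ∀ n, ∃ C, 0 ≤ C ∧ ∀ R x, supSeminorm R (T n x) ≤ C * supSeminorm (R + 1) x)
    {l : Filter ℕ} [l.NeBot] (hl : l ≤ atTop) (hX0 : ∀ x ∈ X, Tendsto (fun n => T n x) l (𝓝 0))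
    (hlift : Dense (liftable T : Set H)) (Y : ℕ → H) {f : H} (hf : f ∈ X) :
    ∃ g : ℕ → Stage X, ∀ t, Stage.IsNext T Y f t g (g t) := by
  refine exists_seq_of_history (Stage.IsNext T Y f) (fun t g g' a hg h => ?_)
    (exists_stage hX hT hl hX0 hlift Y hf)
  constructor
  · exact fun i hi => hg i hi ▸ h.deg_lt i hi
  · exact fun i hi => hg i hi ▸ h.map_monom i hi
  · exact h.approx_sub
  · exact fun i hi => hg i hi ▸ h.map_approx_sub i hi
  · exact h.map_approx_self
  · exact fun i hi => hg i hi ▸ h.map_approx i hi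
  · exact fun i hi => hg i hi ▸ h.map_corr_prev i hi
  · exact h.map_fixed
  · exact h.corr_le
  · exact fun i hi => hg i hi ▸ h.map_corr i hi
  · exact h.map_corr_self

/-! ### Perturbing the identity through bounded sequences -/

open BoundedContinuousFunction

/-- The Taylor coefficients of entire functions at the places `N t`, as a linear map into the
bounded sequences. -/
def coeffSeqₗ (N : ℕ → ℕ) : H →ₗ[ℂ] (ℕ →ᵇ ℂ) where
  toFun x := BoundedContinuousFunction.ofNormedAddCommGroupDiscrete
    (fun t => taylorCoeff (N t) x) (supSeminorm 0 x) fun _ => norm_taylorCoeff_le _ _ _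
  map_add' x y := by ext t; simp
  map_smul' c x := by ext t; simp

theorem norm_coeffSeqₗ_le (N : ℕ → ℕ) (x : H) : ‖coeffSeqₗ N x‖ ≤ supSeminorm 0 x :=
  (BoundedContinuousFunction.norm_le (apply_nonneg _ _)).2 fun _ => norm_taylorCoeff_le _ _ _

/-- The Taylor coefficients of entire functions at the places `N t`, as a continuous linear map into
the bounded sequences. -/
def coeffSeq (N : ℕ → ℕ) : H →L[ℂ] (ℕ →ᵇ ℂ) where
  toLinearMap := coeffSeqₗ N
  cont := by
    refine withSeminorms_supSeminorm.continuous_normedSpace_rng (ℕ →ᵇ ℂ) (coeffSeqₗ N)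
      ⟨{0}, 1, fun x => ?_⟩
    rw [one_smul, Finset.sup_singleton]
    exact norm_coeffSeqₗ_le N x

theorem norm_coeffSeq_le (N : ℕ → ℕ) (x : H) : ‖coeffSeq N x‖ ≤ supSeminorm 0 x :=
  norm_coeffSeqₗ_le N x

theorem summable_supSeminorm_of_le_geometric {w : ℕ → H}
    (hw : ∀ t, supSeminorm t (w t) ≤ (1 / 2) ^ t / 8) (R : ℕ) :
    Summable fun t => supSeminorm R (w t) := by
  refine Summable.of_norm_bounded_eventually_nat (summable_geometric_two.div_const 8) ?_
  filter_upwards [eventually_ge_atTop R] with t ht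
  rw [Real.norm_of_nonneg (apply_nonneg _ _)]
  exact (supSeminorm_mono ht _).trans (hw t)

theorem exists_synthesis {w v : ℕ → H} (hw : ∀ t, supSeminorm t (w t) ≤ (1 / 2) ^ t / 8)
    (hv : ∀ t, supSeminorm t (v t) ≤ (1 / 2) ^ t / 8) (k : ℕ → ℕ) :
    ∃ S : (ℕ →ᵇ ℂ) →L[ℂ] H, (∀ b, HasSum (fun t => b t • w t + b (k t) • v t) (S b)) ∧
      ∀ b, supSeminorm 0 (S b) ≤ 1 / 2 * ‖b‖ := by
  have hbd (R : ℕ) (b : ℕ →ᵇ ℂ) (t : ℕ) : supSeminorm R (b t • w t + b (k t) • v t) ≤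
      ‖b‖ * (supSeminorm R (w t) + supSeminorm R (v t)) := by
    refine (map_add_le_add _ _ _).trans ?_
    rw [map_smul_eq_mul, map_smul_eq_mul, mul_add]
    exact add_le_add (mul_le_mul_of_nonneg_right (b.norm_coe_le_norm _) (apply_nonneg _ _))
      (mul_le_mul_of_nonneg_right (b.norm_coe_le_norm _) (apply_nonneg _ _))
  have hs (R : ℕ) : Summable fun t => supSeminorm R (w t) + supSeminorm R (v t) :=
    (summable_supSeminorm_of_le_geometric hw R).add (summable_supSeminorm_of_le_geometric hv R)
  have hsum (b : ℕ →ᵇ ℂ) : HasSum (fun t => b t • w t + b (k t) • v t)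
      (∑' t, (b t • w t + b (k t) • v t)) :=
    (summable_of_summable_supSeminorm fun R =>
      ((hs R).mul_left ‖b‖).of_nonneg_of_le (fun _ => apply_nonneg _ _) (hbd R b)).hasSum
  let S₀ : (ℕ →ᵇ ℂ) →ₗ[ℂ] H :=
    { toFun := fun b => ∑' t, (b t • w t + b (k t) • v t)
      map_add' := fun b c => by
        refine (hsum (b + c)).unique ?_
        convert (hsum b).add (hsum c) using 2 with t
        simp only [BoundedContinuousFunction.add_apply, add_smul]
        abel
      map_smul' := fun c b => by
        refine (hsum (c • b)).unique ?_
        rw [RingHom.id_apply]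
        convert (hsum b).const_smul c using 2 with t
        simp only [BoundedContinuousFunction.smul_apply, smul_add, smul_eq_mul, mul_smul] }
  have hS₀ : Continuous S₀ := by
    refine withSeminorms_supSeminorm.continuous_normedSpace_dom (ℕ →ᵇ ℂ) S₀ fun R => ?_
    have h0 : 0 ≤ ∑' t, (supSeminorm R (w t) + supSeminorm R (v t)) :=
      tsum_nonneg fun t => add_nonneg (apply_nonneg _ _) (apply_nonneg _ _)
    refine ⟨⟨_, h0⟩, fun b => ?_⟩
    refine (supSeminorm_le_of_hasSum (hsum b) ((hs R).hasSum.mul_left ‖b‖) (hbd R b)).trans ?_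
    rw [mul_comm]
    exact le_rfl
  refine ⟨⟨S₀, hS₀⟩, hsum, fun b => ?_⟩
  -- The two bounds `(1 / 2) ^ t / 8` add up to `(1 / 2) ^ t / 4`, whose sum over `t` is `1 / 2`.
  refine supSeminorm_le_of_hasSum (hsum b) (u := fun t => ‖b‖ / 4 * (1 / 2) ^ t) ?_ fun t => ?_
  · have h1 := hasSum_geometric_two.mul_left (‖b‖ / 4)
    rwa [show ‖b‖ / 4 * 2 = 1 / 2 * ‖b‖ by ring] at h1
  · refine (hbd 0 b t).trans ?_
    have h1 := (supSeminorm_mono t.zero_le _).trans (hw t)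
    have h2 := (supSeminorm_mono t.zero_le _).trans (hv t)
    calc ‖b‖ * (supSeminorm 0 (w t) + supSeminorm 0 (v t))
        ≤ ‖b‖ * ((1 / 2) ^ t / 8 + (1 / 2) ^ t / 8) := by gcongr
      _ = _ := by ring

/-- If `1 + A S` is a small perturbation of the identity of a Banach space `B`, then `1 + S A` is an
isomorphism. -/
theorem exists_equiv_of_norm_comp_lt {X B : Type*} [AddCommGroup X] [Module ℂ X]
    [TopologicalSpace X] [IsTopologicalAddGroup X] [NormedAddCommGroup B] [NormedSpace ℂ B]
    [CompleteSpace B] (A : X →L[ℂ] B) (S : B →L[ℂ] X) (h : ‖A ∘L S‖ < 1) :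
    ∃ e : X ≃L[ℂ] X, ∀ x, e x = x + S (A x) := by
  obtain ⟨J, hJ⟩ : IsUnit (1 + A ∘L S) := by
    simpa using isUnit_one_sub_of_norm_lt_one (x := -(A ∘L S)) (by rwa [norm_neg])
  have h1 (b : B) : J.inv b + A (S (J.inv b)) = b := by
    have := DFunLike.congr_fun J.mul_inv b
    rw [hJ] at this
    exact this
  have h2 (b : B) : J.inv (b + A (S b)) = b := by
    have := DFunLike.congr_fun J.inv_mul b
    rw [hJ] at this
    exact this
  -- The inverse of `1 + S A` is `1 - S (1 + A S)⁻¹ A`; only `1 + A S`, on the Banach space, is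
  -- inverted by a Neumann series.
  refine ⟨ContinuousLinearEquiv.equivOfInverse (ContinuousLinearMap.id ℂ X + S ∘L A)
    (ContinuousLinearMap.id ℂ X - S ∘L J.inv ∘L A) (fun x => ?_) (fun x => ?_), fun x => rfl⟩
  · change (x + S (A x)) - S (J.inv (A (x + S (A x)))) = x
    rw [map_add A, h2, add_sub_cancel_right]
  · change (x - S (J.inv (A x))) + S (A (x - S (J.inv (A x)))) = x
    have := congrArg S (h1 (A x))
    rw [map_add] at this
    rw [map_sub A, map_sub S, ← this]
    abel

/-! ### Lacunary power series: closedness and dimension -/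

/-- The entire functions whose Taylor series involves only powers `z ^ N t`. -/
def lacunary (N : ℕ → ℕ) : Submodule ℂ H where
  carrier := {x | ∀ j ∉ Set.range N, taylorCoeff j x = 0}
  add_mem' hx hy j hj := by rw [map_add, hx j hj, hy j hj, add_zero]
  zero_mem' j _ := map_zero _
  smul_mem' c x hx j hj := by rw [map_smul, hx j hj, smul_zero]

theorem isClosed_lacunary (N : ℕ → ℕ) : IsClosed (lacunary N : Set H) := by
  have : (lacunary N : Set H) = ⋂ j ∈ (Set.range N)ᶜ, {x | taylorCoeff j x = 0} := by
    ext x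
    simp [lacunary]
  rw [this]
  exact isClosed_biInter fun j _ => isClosed_eq (taylorCoeff j).continuous continuous_const

theorem isClosed_lacunary_sup_span (N : ℕ → ℕ) (q : H) :
    IsClosed ((lacunary N ⊔ Submodule.span ℂ {q} : Submodule ℂ H) : Set H) := by
  by_cases hq : q ∈ lacunary N
  · rw [sup_eq_left.2 ((Submodule.span_singleton_le_iff_mem _ _).2 hq)]
    exact isClosed_lacunary N
  · obtain ⟨j, hj, hjq⟩ : ∃ j ∉ Set.range N, taylorCoeff j q ≠ 0 := by
      by_contra! h
      exact hq h
    -- A coefficient `j` vanishing on `lacunary N` but not at `q` reads off the multiple of `q`, so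
    -- the sum is a preimage of `lacunary N` under a continuous map.
    have : ((lacunary N ⊔ Submodule.span ℂ {q} : Submodule ℂ H) : Set H) =
        (fun x => x - (taylorCoeff j x / taylorCoeff j q) • q) ⁻¹' (lacunary N : Set H) := by
      ext x
      rw [SetLike.mem_coe, Submodule.mem_sup, Set.mem_preimage, SetLike.mem_coe]
      constructor
      · rintro ⟨y, hy, _, hz, rfl⟩
        obtain ⟨c, rfl⟩ := Submodule.mem_span_singleton.1 hz
        rw [map_add, hy j hj, zero_add, map_smul, smul_eq_mul, mul_div_cancel_right₀ _ hjq,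
          add_sub_cancel_right]
        exact hy
      · exact fun h => ⟨_, h, _, Submodule.mem_span_singleton.2 ⟨_, rfl⟩, sub_add_cancel _ _⟩
    rw [this]
    refine (isClosed_lacunary N).preimage (continuous_id.sub ?_)
    exact ((taylorCoeff j).continuous.div_const _).smul continuous_const

theorem hasSum_of_mem_lacunary {N : ℕ → ℕ} (hN : Function.Injective N) {x : H}
    (hx : x ∈ lacunary N) : HasSum (fun t => taylorCoeff (N t) x • monom (N t)) x :=
  (hN.hasSum_iff (f := fun j => taylorCoeff j x • monom j) fun j hj => by
    rw [hx j hj, zero_smul]).2 (hasSum_taylorCoeff_smul_monom x)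

theorem exists_taylorCoeff_ne_zero {N : ℕ → ℕ} {x : H} (hx : x ∈ lacunary N) (h0 : x ≠ 0) :
    ∃ t, taylorCoeff (N t) x ≠ 0 := by
  by_contra! h
  refine h0 (taylorCoeff_ext fun j => ?_)
  rw [map_zero]
  by_cases hj : j ∈ Set.range N
  · obtain ⟨t, rfl⟩ := hj
    exact h t
  · exact hx j hj

theorem mk_H_le : Cardinal.mk H ≤ Cardinal.continuum := by
  have : Function.Injective fun (x : H) (j : ℕ) => taylorCoeff j x :=
    fun x y h => taylorCoeff_ext (congrFun h)
  refine (Cardinal.mk_le_of_injective this).trans ?_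
  simp

theorem exists_mem_lacunary_taylorCoeff {N : ℕ → ℕ} (hN : StrictMono N) (c : ℂ) :
    ∃ x ∈ lacunary N, ∀ t, taylorCoeff (N t) x = ((N t).factorial : ℂ)⁻¹ * c ^ t := by
  have hsum : Summable fun t => (((N t).factorial : ℂ)⁻¹ * c ^ t) • monom (N t) := by
    refine summable_of_summable_supSeminorm fun R => ?_
    refine ((Real.summable_pow_div_factorial ((1 + ‖c‖) * (R + 1))).comp_injective
      hN.injective).of_nonneg_of_le (fun _ => apply_nonneg _ _) fun t => ?_
    rw [map_smul_eq_mul, norm_mul, norm_inv, Complex.norm_natCast, norm_pow, Function.comp_apply]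
    have h1 : ‖c‖ ^ t ≤ (1 + ‖c‖) ^ N t :=
      (pow_le_pow_left₀ (norm_nonneg c) (by linarith) t).trans
        (pow_le_pow_right₀ (by linarith [norm_nonneg c]) (hN.id_le t))
    calc _ ≤ ((N t).factorial : ℝ)⁻¹ * (1 + ‖c‖) ^ N t * (R + 1 : ℝ) ^ N t := by
          gcongr
          exact supSeminorm_monom_le R (N t)
      _ = _ := by rw [mul_pow]; ring
  have hcoeff (i : ℕ) := (taylorCoeff i).hasSum hsum.hasSum
  simp only [map_smul, taylorCoeff_monom, smul_eq_mul, mul_ite, mul_one, mul_zero] at hcoeff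
  refine ⟨_, fun j hj => ?_, fun t => (hcoeff (N t)).unique ?_⟩
  · refine (hcoeff j).unique ?_
    convert hasSum_zero (α := ℂ) (β := ℕ) using 2 with t
    exact if_neg fun h => hj ⟨t, h.symm⟩
  · convert hasSum_ite_eq t (((N t).factorial : ℂ)⁻¹ * c ^ t) using 2 with s
    by_cases hst : s = t
    · simp [hst]
    · rw [if_neg hst, if_neg fun h => hst (hN.injective h.symm)]

/-- Multiplying the coefficient at `N t` by `(N t)!` turns the functions of the previous lemma into
`t ↦ c ^ t`, distinct characters of `Multiplicative ℕ`, which are independent by Dedekind's lemma.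
-/
theorem continuum_le_rank_lacunary {N : ℕ → ℕ} (hN : StrictMono N) :
    Cardinal.continuum ≤ Module.rank ℂ (lacunary N) := by
  choose x hx hxc using fun c => exists_mem_lacunary_taylorCoeff hN c
  let L : lacunary N →ₗ[ℂ] (Multiplicative ℕ → ℂ) :=
    { toFun := fun y t => ((N t.toAdd).factorial : ℂ) * taylorCoeff (N t.toAdd) (y : H)
      map_add' := fun y z => by ext t; simp [mul_add]
      map_smul' := fun a y => by ext t; simp; ring }
  have hli : LinearIndependent ℂ fun c : ℂ => (⟨x c, hx c⟩ : lacunary N) := by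
    refine LinearIndependent.of_comp L ?_
    have h1 := (linearIndependent_monoidHom (Multiplicative ℕ) ℂ).comp (powersHom ℂ)
      (powersHom ℂ).injective
    have h2 : (L ∘ fun c : ℂ => (⟨x c, hx c⟩ : lacunary N)) =
        (fun φ : Multiplicative ℕ →* ℂ => (φ : Multiplicative ℕ → ℂ)) ∘ powersHom ℂ := by
      ext c t
      change ((N t.toAdd).factorial : ℂ) * taylorCoeff (N t.toAdd) (x c) = c ^ t.toAdd
      rw [hxc, mul_inv_cancel_left₀ (by exact_mod_cast Nat.factorial_ne_zero _)]
    rw [h2]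
    exact h1
  simpa using hli.cardinal_le_rank

/-! ### Hypercyclicity of the perturbed functions and conclusion -/

/-- For `t ≤ s` the monomial and its perturbation recombine to `b t • approx`, which `T (g s).idx`
makes small. For `t > s` they are estimated apart: the perturbation is small, and the growth `(R +
3) ^ deg` of the monomial's image is absorbed by the Cauchy bound on `b t`, whence the seminorm of
index `R + 2`. -/
theorem supSeminorm_map_sub_le {X : Submodule ℂ H} {T : ℕ → H →L[ℂ] H} {Y : ℕ → H} {f : H}
    {g : ℕ → Stage X} (hg : ∀ t, Stage.IsNext T Y f t g (g t))
    (hN : Function.Injective fun t => (g t).deg) {k : ℕ → ℕ} {S : (ℕ →ᵇ ℂ) →L[ℂ] H}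
    (hS : ∀ b : ℕ →ᵇ ℂ, HasSum (fun t => b t • ((g t).approx - monom (g t).deg) +
      b (k t) • ((g t).corr : H)) (S b))
    {x : H} (hx : x ∈ lacunary fun t => (g t).deg) {R s : ℕ} (hRs : R ≤ s) :
    supSeminorm R (T (g s).idx (x + S (coeffSeq (fun t => (g t).deg) x)) -
      taylorCoeff (g (k s)).deg x • Y s) ≤ (1 / 2) ^ s * (7 * supSeminorm (R + 2) x) := by
  set b := coeffSeq (fun t => (g t).deg) x
  set B := supSeminorm (R + 2) x
  have hb (t : ℕ) : ‖b t‖ ≤ B := norm_taylorCoeff_le _ _ _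
  have hb3 (t : ℕ) : ‖b t‖ * (R + 3 : ℝ) ^ (g t).deg ≤ B := by
    have := norm_taylorCoeff_mul_le (g t).deg (R + 2) x
    push_cast at this
    rwa [add_assoc, show (2 : ℝ) + 1 = 3 by norm_num] at this
  have hB : 0 ≤ B := apply_nonneg _ _
  set L := T (g s).idx
  have h0 : HasSum (fun t => b t • monom (g t).deg) x := hasSum_of_mem_lacunary hN hx
  have h1 := L.hasSum (h0.add (hS b))
  have h2 := h1.sub (hasSum_ite_eq s (b (k s) • Y s))
  -- At most three errors `B (1 / 2) ^ (s + t)` per `t` sum to `6 B (1 / 2) ^ s`; the error of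
  -- `corr` against `Y s` at `t = s` adds one more, giving `7`.
  refine supSeminorm_le_of_hasSum h2 (u := fun t => (1 / 2) ^ s * (3 * B) * (1 / 2) ^ t +
    if t = s then (1 / 2) ^ s * B else 0) ?_ fun t => ?_
  · have h3 := (hasSum_geometric_two.mul_left ((1 / 2 : ℝ) ^ s * (3 * B))).add
      (hasSum_ite_eq s ((1 / 2 : ℝ) ^ s * B))
    rwa [show (1 / 2 : ℝ) ^ s * (3 * B) * 2 + (1 / 2) ^ s * B = (1 / 2) ^ s * (7 * B) by ring] at h3
  have hsmul (c : ℂ) (y : H) {δ : ℝ} (hc : ‖c‖ ≤ B) (hy : supSeminorm R y ≤ δ) :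
      supSeminorm R (c • y) ≤ B * δ := by
    rw [map_smul_eq_mul]
    exact mul_le_mul hc hy (apply_nonneg _ _) hB
  have hδ : 0 ≤ B * (1 / 2 : ℝ) ^ (s + t) := by positivity
  rw [mul_right_comm, ← mul_assoc ((1 / 2 : ℝ) ^ s * (1 / 2) ^ t), ← pow_add]
  rcases lt_trichotomy t s with hts | rfl | hts
  · rw [if_neg hts.ne, if_neg hts.ne, sub_zero, add_zero, ← add_assoc, ← smul_add, add_sub_cancel,
      map_add L, map_smul L, map_smul L]
    have e1 := hsmul (b t) _ (hb t) ((supSeminorm_mono hRs _).trans ((hg s).map_approx t hts))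
    have e2 := hsmul (b (k t)) _ (hb _) ((supSeminorm_mono hRs _).trans ((hg s).map_corr_prev t hts))
    refine (map_add_le_add _ _ _).trans ?_
    linarith
  · rw [if_pos rfl, if_pos rfl, ← add_assoc, ← smul_add, add_sub_cancel, map_add L, map_smul L,
      map_smul L,      add_sub_assoc, ← smul_sub]
    have e1 := hsmul (b t) _ (hb t) ((supSeminorm_mono hRs _).trans (hg t).map_approx_self)
    have e2 := hsmul (b (k t)) _ (hb _) ((supSeminorm_mono hRs _).trans (hg t).map_corr_self)
    refine (map_add_le_add _ _ _).trans ?_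
    linarith
  · rw [if_neg hts.ne', if_neg hts.ne', sub_zero, add_zero, map_add L, map_add L, map_smul L,
      map_smul L, map_smul L]
    have e0 : supSeminorm R (b t • L (monom (g t).deg)) ≤ B * (1 / 2) ^ (s + t) := by
      rw [map_smul_eq_mul]
      calc _ ≤ ‖b t‖ * ((1 / 2) ^ (s + t) * (R + 3 : ℝ) ^ (g t).deg) := by
            gcongr
            exact (hg t).map_monom s hts R hRs
        _ = ‖b t‖ * (R + 3 : ℝ) ^ (g t).deg * (1 / 2) ^ (s + t) := by ring
        _ ≤ _ := by gcongr; exact hb3 t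
    have e1 := hsmul (b t) _ (hb t) ((supSeminorm_mono (hRs.trans hts.le) _).trans
      ((hg t).map_approx_sub s hts))
    have e2 := hsmul (b (k t)) _ (hb _) ((supSeminorm_mono (hRs.trans hts.le) _).trans
      ((hg t).map_corr s hts))
    refine (map_add_le_add _ _ _).trans ?_
    have e3 := map_add_le_add (supSeminorm R) (b t • L ((g t).approx - monom (g t).deg))
      (b (k t) • L (g t).corr)
    linarith

/-- To approach `z`, pick `Y' l` near `z / b i` and then a late `s` scheduled for `(i, l)`. -/
theorem mem_HC_of_approx {T : ℕ → H →L[ℂ] H} {k n : ℕ → ℕ} {Y Y' : ℕ → H}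
    (hY' : Dense (Set.range Y')) (hsched : ∀ i l M, ∃ s ≥ M, k s = i ∧ Y s = Y' l) {y : H}
    {b : ℕ → ℂ} {i : ℕ} (hi : b i ≠ 0)
    (h : ∀ R, ∃ C, ∀ s ≥ R, supSeminorm R (T (n s) y - b (k s) • Y s) ≤ (1 / 2) ^ s * C) :
    y ∈ HC T := by
  refine fun z => mem_closure_iff_nhds.2 fun U hU => ?_
  obtain ⟨R, ε, hε, hU⟩ := exists_supSeminorm_lt_subset hU
  obtain ⟨C, hC⟩ := h R
  have hb : 0 < ‖b i‖ := norm_pos_iff.2 hi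
  obtain ⟨_, ⟨l, rfl⟩, hl⟩ := exists_supSeminorm_sub_lt hY' ((b i)⁻¹ • z) R
    (ε := ε / (2 * ‖b i‖)) (by positivity)
  have hlim : Tendsto (fun s : ℕ => (1 / 2 : ℝ) ^ s * C) atTop (𝓝 0) := by
    simpa using (tendsto_pow_atTop_nhds_zero_of_lt_one (r := (1 / 2 : ℝ)) (by norm_num)
      (by norm_num)).mul_const C
  obtain ⟨M, hM⟩ := eventually_atTop.1 (hlim.eventually_lt_const (half_pos hε))
  obtain ⟨s, hs, hks, hYs⟩ := hsched i l (max M R)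
  refine ⟨T (n s) y, hU _ ?_, n s, rfl⟩
  have e1 := (hC s (le_of_max_le_right hs)).trans_lt (hM s (le_of_max_le_left hs))
  rw [hks, hYs] at e1
  have e2 : supSeminorm R (b i • Y' l - z) < ε / 2 := by
    have : b i • Y' l - z = b i • (Y' l - (b i)⁻¹ • z) := by rw [smul_sub, smul_inv_smul₀ hi]
    rw [this, map_smul_eq_mul]
    calc _ < ‖b i‖ * (ε / (2 * ‖b i‖)) := mul_lt_mul_of_pos_left hl hb
      _ = ε / 2 := by field_simp
  calc supSeminorm R (T (n s) y - z)
      = supSeminorm R ((T (n s) y - b i • Y' l) + (b i • Y' l - z)) := by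
        rw [sub_add_sub_cancel]
    _ ≤ _ := map_add_le_add _ _ _
    _ < ε / 2 + ε / 2 := add_lt_add e1 e2
    _ = ε := add_halves ε

theorem smul_mem_HC {T : ℕ → H →L[ℂ] H} {f : H} (hf : f ∈ HC T) {c : ℂ} (hc : c ≠ 0) :
    c • f ∈ HC T := by
  have h1 : Dense ((fun x : H => c • x) '' Set.range fun n => T n f) :=
    (Homeomorph.smulOfNeZero c hc).surjective.denseRange.dense_image
      (continuous_const_smul c) hf
  rw [← Set.range_comp] at h1
  change Dense (Set.range fun n => T n (c • f))
  simp only [map_smul]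
  exact h1

open Classical in
-- `H` has no isolated points, so the orbit stays dense after its first `M` values are removed; it
-- therefore comes near `0` at arbitrarily late indices.
theorem neBot_atTop_inf_comap {f : H} {T : ℕ → H →L[ℂ] H} (hf : f ∈ HC T) :
    (atTop ⊓ comap (fun n => T n f) (𝓝 0)).NeBot := by
  have : ∀ x : H, (𝓝[≠] x).NeBot := Module.punctured_nhds_neBot ℂ H
  rw [inf_neBot_iff]
  rintro s hs _ ⟨U, hU, hUs⟩
  obtain ⟨M, hM⟩ := mem_atTop_sets.1 hs
  have hd := Dense.sdiff_finset hf ((Finset.range M).image fun n => T n f)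
  obtain ⟨_, ⟨⟨n, rfl⟩, hn⟩, hxU⟩ := hd.inter_nhds_nonempty hU
  refine ⟨n, hM n ?_, hUs hxU⟩
  by_contra hlt
  exact hn (Finset.mem_coe.2 (Finset.mem_image_of_mem _ (Finset.mem_range.2 (not_le.1 hlt))))

/-- The vectors on which a sequence of operators tends to `0` along a filter. -/
def nullSpace (T : ℕ → H →L[ℂ] H) (l : Filter ℕ) : Submodule ℂ H where
  carrier := {x | Tendsto (fun n => T n x) l (𝓝 0)}
  add_mem' {x y} hx hy := by
    have : Tendsto (fun n => T n (x + y)) l (𝓝 0) := by simpa using Tendsto.add hx hy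
    exact this
  zero_mem' := by simpa using tendsto_const_nhds
  smul_mem' c x hx := by
    have : Tendsto (fun n => T n (c • x)) l (𝓝 0) := by simpa using Tendsto.const_smul hx c
    exact this

/-- If `T n f → 0` along a filter `l`, then `T n → 0` along `l` on the whole orbit of `f`, because
the operators commute; if `f` is hypercyclic, this orbit is dense. Hence no condition on the
vanishing of `T n` on a dense set is needed. -/
theorem pointwiseSpaceable_HC_of_commute {T : ℕ → H →L[ℂ] H} (hcomm : ∀ m n, Commute (T m) (T n))
    (hT : ∀ n, ∃ C, 0 ≤ C ∧ ∀ R x, supSeminorm R (T n x) ≤ C * supSeminorm (R + 1) x)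
    (hlift : Dense (liftable T : Set H)) : PointwiseSpaceable Cardinal.continuum (HC T) := by
  intro f hf
  set l : Filter ℕ := atTop ⊓ comap (fun n => T n f) (𝓝 0)
  have hlne : l.NeBot := neBot_atTop_inf_comap hf
  have hfX : f ∈ nullSpace T l := tendsto_comap.mono_left inf_le_right
  have hX : Dense (nullSpace T l : Set H) := by
    refine Dense.mono ?_ hf
    rintro _ ⟨m, rfl⟩
    have h1 : Tendsto (fun n => T m (T n f)) l (𝓝 0) := by
      have h0 := (T m).continuous.tendsto 0
      rw [map_zero] at h0
      exact h0.comp hfX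
    refine h1.congr fun n => ?_
    exact DFunLike.congr_fun (hcomm m n).eq f
  -- The targets are the orbit of `f` itself. A stage `t` encodes a triple: coefficient index, orbit
  -- index, and a free counter that repeats each pair infinitely often.
  obtain ⟨g, hg⟩ := exists_stages hX hT inf_le_left (fun x hx => hx) hlift
    (fun t => T t.unpair.2.unpair.1 f) hfX
  set N : ℕ → ℕ := fun t => (g t).deg
  have hN : StrictMono N := fun i t hit => (hg t).deg_lt i hit
  obtain ⟨S, hS, hS0⟩ := exists_synthesis (fun t => (hg t).approx_sub) (fun t => (hg t).corr_le)
    fun t => t.unpair.1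
  obtain ⟨e, he⟩ := exists_equiv_of_norm_comp_lt (coeffSeq N) S <|
    (ContinuousLinearMap.opNorm_le_bound _ (by norm_num : (0 : ℝ) ≤ 1 / 2)
      fun b => (norm_coeffSeq_le N (S b)).trans (hS0 b)).trans_lt (by norm_num)
  -- The subspace sought is `e V`. Adjoining `e.symm f` before applying `e` puts `f` in it and keeps
  -- it closed.
  set V : Submodule ℂ H := lacunary N ⊔ Submodule.span ℂ {e.symm f}
  refine ⟨V.comap (e.symm : H →ₗ[ℂ] H),
    (isClosed_lacunary_sup_span N _).preimage e.symm.continuous, le_antisymm ?_ ?_, ?_, ?_⟩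
  · exact (rank_le_card ℂ _).trans ((Cardinal.mk_le_of_injective Subtype.val_injective).trans mk_H_le)
  · refine (continuum_le_rank_lacunary hN).trans ?_
    let j : lacunary N →ₗ[ℂ] V.comap (e.symm : H →ₗ[ℂ] H) :=
      ((e : H →ₗ[ℂ] H) ∘ₗ (lacunary N).subtype).codRestrict _ fun x => by
        simpa using Submodule.mem_sup_left x.2
    refine LinearMap.rank_le_of_injective j fun x y hxy => ?_
    exact Subtype.ext (e.injective (congrArg Subtype.val hxy))
  · exact Submodule.mem_sup_right (Submodule.mem_span_singleton_self _)
  intro y hy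
  obtain ⟨x, hx, _, hz, hxy⟩ := Submodule.mem_sup.1 (show e.symm y ∈ V from hy)
  obtain ⟨c, rfl⟩ := Submodule.mem_span_singleton.1 hz
  obtain rfl : e x + c • f = y := by
    rw [← e.apply_symm_apply y, ← hxy, map_add, map_smul, e.apply_symm_apply]
  by_cases hx0 : x = 0
  · subst hx0
    rw [map_zero, zero_add]
    by_cases hc : c = 0
    · exact Or.inr (by simp [hc])
    · exact Or.inl (smul_mem_HC hf hc)
  · obtain ⟨i, hi⟩ := exists_taylorCoeff_ne_zero hx hx0
    refine Or.inl (mem_HC_of_approx (k := fun t => t.unpair.1) (n := fun s => (g s).idx)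
      (Y := fun t => T t.unpair.2.unpair.1 f) (b := fun t => taylorCoeff (N t) x) hf
      (fun i m M => ?_) hi fun R => ⟨7 * supSeminorm (R + 2) x + ‖c‖, fun s hs => ?_⟩)
    · refine ⟨Nat.pair i (Nat.pair m M), ?_, by simp, by simp⟩
      exact (Nat.right_le_pair m M).trans (Nat.right_le_pair i _)
    · have e1 := supSeminorm_map_sub_le hg hN.injective hS hx hs
      have e2 : supSeminorm R (c • T (g s).idx f) ≤ ‖c‖ * (1 / 2) ^ s := by
        rw [map_smul_eq_mul]
        exact mul_le_mul_of_nonneg_left ((supSeminorm_mono hs _).trans (hg s).map_fixed)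
          (norm_nonneg _)
      rw [he, map_add, map_smul, add_sub_right_comm]
      refine (map_add_le_add _ _ _).trans ((add_le_add e1 e2).trans_eq ?_)
      ring

end EntireHC

end

theorem theorem4p2 (P : ℕ → Polynomial ℂ)
    (hP : ∀ n, 0 < (P n).natDegree)
    (hm : ¬ BddAbove (Set.range fun n => EntireHC.valence (P n)))
    (hPQR : EntireHC.PropP P ∨ EntireHC.PropQ P ∨ EntireHC.PropR P) :
    EntireHC.PointwiseSpaceable Cardinal.continuum
      (EntireHC.HC fun n => EntireHC.diffOp (P n)) := by
  refine EntireHC.pointwiseSpaceable_HC_of_commute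
    (fun m n => (Commute.all (P m) (P n)).map (aeval EntireHC.D))
    (fun n => EntireHC.exists_supSeminorm_diffOp_le (P n)) ?_
  rcases hPQR with h | h | h
  · exact EntireHC.dense_liftable_of_propP h
  · exact EntireHC.dense_liftable_of_propQ
      (fun n h0 => by simpa [h0] using hP n) h
  · exact EntireHC.dense_liftable_of_propP h.propP
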